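/- Let $\mathcal{G}$ be the group, under composition, of polynomial automorphisms of the affine plane over $\mathbb{C}$, each written as a pair $\theta=(F_1,F_2)\in\mathbb{C}[X,Y]^2$, and put $\deg\theta=\max(\deg F_1,\deg F_2)$. Let $\mathcal{A}\subset\mathcal{G}$ be the subgroup of affine automorphisms (those of degree one) and $\mathcal{B}\subset\mathcal{G}$ the subgroup of triangular automorphisms $(aX+P(Y),\,bY+c)$ with $a,b\in\mathbb{C}^*$, $c\in\mathbb{C}$, $P\in\mathbb{C}[Y]$. For a sequence $(d_1,\dots,d_k)$ of positive integers let $\mathcal{G}_{(d_1,\dots,d_k)}$ be the set of automorphisms of polydegree $(d_1,\dots,d_k)$, that is, of those $\theta\in\mathcal{G}$ that can be written as a reduced product $$\theta=\alpha_0\tau_1\alpha_1\cdots\tau_k\alpha_k$$ with $\alpha_i\in\mathcal{A}$ for $0\le i\le k$, $\alpha_i\notin\mathcal{B}$ for $0<i<k$, $\tau_i\in\mathcal{B}\setminus\mathcal{A}$ and $\deg\tau_i=d_i$ for $1\le i\le k$. Equip $\mathcal{G}$ with the Zariski topology of its ind-variety structure: $S\subset\mathcal{G}$ is closed if and only if for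 every $n\in\mathbb{N}$ the set $\{\theta\in S:\deg\theta\le n\}$ is the set of common zeros, in $\{\theta\in\mathcal{G}:\deg\theta\le n\}$, of a family of polynomials in the coefficients of $F_1$ and $F_2$. **Theorem (Furter).** For every integer $d\ge 2$, $$\mathcal{G}_{(d+2)}\subset\overline{\mathcal{G}_{(d,3)}},$$ where the bar denotes the closure in $\mathcal{G}$ in the Zariski topology. -/

import Mathlib

/-- The group `𝒢(K)` of automorphisms of the affine plane `Spec K[X, Y]` over `K`: the opposite
group of the group of `K`-algebra automorphisms of `K[X, Y]`, so that multiplication is the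
composition of maps of the plane (see `PlaneAut.component_mul`). -/
def PlaneAut (K : Type*) [Field K] : Type _ :=
  (MvPolynomial (Fin 2) K ≃ₐ[K] MvPolynomial (Fin 2) K)ᵐᵒᵖ

namespace PlaneAut

noncomputable instance instGroup (K : Type*) [Field K] : Group (PlaneAut K) :=
  inferInstanceAs (Group (MvPolynomial (Fin 2) K ≃ₐ[K] MvPolynomial (Fin 2) K)ᵐᵒᵖ)

/-- The comorphism of a plane automorphism. -/
def comorphism {K : Type*} [Field K] (θ : PlaneAut K) :
    MvPolynomial (Fin 2) K ≃ₐ[K] MvPolynomial (Fin 2) K :=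
  MulOpposite.unop θ

/-- The components `(F₀, F₁)` of a plane automorphism, where `X = X 0` and `Y = X 1`. -/
noncomputable def component {K : Type*} [Field K] (θ : PlaneAut K) (i : Fin 2) :
    MvPolynomial (Fin 2) K :=
  θ.comorphism (MvPolynomial.X i)

/-- Multiplication is composition of polynomial maps: `(F ∘ G)_i = F_i(G₀, G₁)`. -/
theorem component_mul {K : Type*} [Field K] (θ σ : PlaneAut K) (i : Fin 2) :
    (θ * σ).component i = MvPolynomial.aeval σ.component (θ.component i) := by
  have h : (σ.comorphism : MvPolynomial (Fin 2) K →ₐ[K] MvPolynomial (Fin 2) K)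
      = MvPolynomial.aeval σ.component := by
    apply MvPolynomial.algHom_ext
    intro j
    simp [component]
  exact DFunLike.congr_fun h (θ.component i)

/-- The degree of an automorphism: the maximum of the degrees of its components. -/
noncomputable def degree {K : Type*} [Field K] (θ : PlaneAut K) : ℕ :=
  max (θ.component 0).totalDegree (θ.component 1).totalDegree

/-- Membership in the affine subgroup `𝒜(K)`: the automorphisms of degree one (the degree of an
automorphism is never zero). -/
def IsAffine {K : Type*} [Field K] (θ : PlaneAut K) : Prop :=
  θ.degree ≤ 1

/-- Membership in the upper triangular subgroup `ℬ(K)`: the automorphisms of the form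
`(aX + P(Y), bY + c)` with `a, b ∈ K*`, `c ∈ K`, `P ∈ K[Y]`. -/
def IsTriangular {K : Type*} [Field K] (θ : PlaneAut K) : Prop :=
  ∃ (a b c : K) (P : Polynomial K), a ≠ 0 ∧ b ≠ 0 ∧
    θ.component 0 = MvPolynomial.C a * MvPolynomial.X 0
      + Polynomial.aeval (MvPolynomial.X 1 : MvPolynomial (Fin 2) K) P ∧
    θ.component 1 = MvPolynomial.C b * MvPolynomial.X 1 + MvPolynomial.C c

/-- `θ` has polydegree `(d₁, …, d_k)`: it is a reduced product `α₀ τ₁ α₁ ⋯ τ_k α_k` in the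
amalgamated product of `𝒜(K)` and `ℬ(K)`, that is `α_i ∈ 𝒜(K)` for all `i`,
`α_i ∉ ℬ(K)` for `0 < i < k`, and `τ_i ∈ ℬ(K) \ 𝒜(K)`; and `deg τ_i = d_i`.
In the code the factors `τ` are numbered from `0`. -/
def HasPolydegree {K : Type*} [Field K] (θ : PlaneAut K) (d : List ℕ) : Prop :=
  ∃ (α : Fin (d.length + 1) → PlaneAut K) (τ : Fin d.length → PlaneAut K),
    (∀ i, (α i).IsAffine) ∧
    (∀ i, i ≠ 0 → i ≠ Fin.last d.length → ¬ (α i).IsTriangular) ∧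
    (∀ i, (τ i).IsTriangular ∧ ¬ (τ i).IsAffine) ∧
    (∀ i, (τ i).degree = d.get i) ∧
    θ = α 0 * (List.ofFn fun i : Fin d.length => τ i * α i.succ).prod

/-- The set `𝒢_{(d₁, …, d_k)}(K)` of automorphisms with polydegree `(d₁, …, d_k)`. -/
def polydegreeSet (K : Type*) [Field K] (d : List ℕ) : Set (PlaneAut K) :=
  {θ | θ.HasPolydegree d}

/-- The coordinates of an automorphism in `(ℂ[X, Y])²`: the coefficients of its components. -/
noncomputable def coords (θ : PlaneAut ℂ) : Fin 2 × (Fin 2 →₀ ℕ) → ℂ :=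
  fun p => (θ.component p.1).coeff p.2

/-- A subset of `𝒢 = 𝒢(ℂ)` is Zariski closed in the ind-variety `𝒢 = ⋃ₙ 𝒢_{≤ n}` if, for each
`n`, its trace on the set `𝒢_{≤ n}` of automorphisms of degree at most `n` is cut out by
polynomial equations in the coefficients. -/
def IsZariskiClosed (S : Set (PlaneAut ℂ)) : Prop :=
  ∀ n : ℕ, ∃ I : Set (MvPolynomial (Fin 2 × (Fin 2 →₀ ℕ)) ℂ),
    ∀ θ : PlaneAut ℂ, θ.degree ≤ n →
      (θ ∈ S ↔ ∀ p ∈ I, MvPolynomial.eval θ.coords p = 0)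

/-- The Zariski topology of the ind-variety `𝒢 = 𝒢(ℂ)`. -/
noncomputable instance zariskiTopology : TopologicalSpace (PlaneAut ℂ) :=
  TopologicalSpace.ofClosed {S | IsZariskiClosed S}
    (by
      intro n
      refine ⟨{1}, fun θ _ => ?_⟩
      simp)
    (by
      intro A hA n
      choose! I hI using fun S (hS : S ∈ A) => hA hS n
      refine ⟨⋃ S ∈ A, I S, fun θ hθ => ?_⟩
      simp only [Set.mem_sInter, Set.mem_iUnion]
      constructor
      · rintro h p ⟨S, hS, hp⟩
        exact (hI S hS θ hθ).1 (h S hS) p hp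
      · intro h S hS
        exact (hI S hS θ hθ).2 fun p hp => h p ⟨S, hS, hp⟩)
    (by
      intro S hS T hT n
      obtain ⟨I, hI⟩ := hS n
      obtain ⟨J, hJ⟩ := hT n
      refine ⟨{r | ∃ p ∈ I, ∃ q ∈ J, r = p * q}, fun θ hθ => ?_⟩
      rw [Set.mem_union, hI θ hθ, hJ θ hθ]
      constructor
      · rintro (h | h) r ⟨p, hp, q, hq, rfl⟩
        · simp [h p hp]
        · simp [h q hq]
      · intro h
        by_contra! hcon
        obtain ⟨⟨p, hp, hp0⟩, q, hq, hq0⟩ := hcon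
        have := h _ ⟨p, hp, q, hq, rfl⟩
        rw [map_mul] at this
        exact (mul_ne_zero hp0 hq0) this)

theorem isClosed_iff (S : Set (PlaneAut ℂ)) : IsClosed S ↔ IsZariskiClosed S := by
  rw [← isOpen_compl_iff]
  change IsZariskiClosed Sᶜᶜ ↔ _
  rw [compl_compl]

end PlaneAut

/-! Up to affine factors, the target is a one-parameter degeneration. For t ≠ 0, put U = t^(d+1) X +
Y q(tY) with q quadratic; a product τ₁ ∘ (Y, X) ∘ τ₂ of degrees d and 3 gives (t^(-(d+1)) Y -
t^(-(d+2)) p(tU) - L(U) - t U^d, U), where p and L have degree at most d. If p(Zq(Z)) = Z + r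
Z^(d+2) + O(Z^(d+3)), Taylor expansion of p(tU) around tYq(tY) cancels the pole, and at t = 0 the
family becomes (-p'(0) X - r Y^(d+2) - L(q(0)Y), q(0)Y). An equation satisfied for infinitely many t
also holds at t = 0, so this limit lies in the closure. Choosing L and composing with affine
triangular maps gives every triangular map of degree d + 2 (`isPolynomialLimit_triangular`,
`mainTheorem5`).

It remains to find p and q with r ≠ 0 (`exists_comp_cubic_eq`). The local inverse of the cubic Zq
must have zero Taylor coefficient in degree d + 1 and nonzero coefficient in degree d + 2; p is then
its truncation. Take z = y^3 - 3y recentred at a point y. The (k+1)-st derivative of its inverse is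
3^k N_k(y) / (3(y^2 - 1))^(2k+1), with N_k = `cubicInverseNum k` of degree k, so N_d has a root when
d ≥ 1. Since y^3 - 3y is a Chebyshev polynomial up to scaling, the inverse satisfies a linear
second-order differential equation. The resulting three-term recurrence prevents N_d and N_(d+1)
from vanishing together. -/

open Polynomial in
/-- Numerators of the derivatives of the inverse function of `y ^ 3 - 3 * y`. -/
noncomputable def cubicInverseNum : ℕ → ℂ[X]
  | 0 => 1
  | n + 1 => (X ^ 2 - 1) * derivative (cubicInverseNum n) - C (4 * n + 2 : ℂ) * X * cubicInverseNum n

/-! ### Numerators of the derivatives of the inverse cubic -/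

namespace cubicInverseNum

open Polynomial

theorem succ_eq (n : ℕ) : cubicInverseNum (n + 1) = (X ^ 2 - 1) * derivative (cubicInverseNum n)
    - C (4 * n + 2 : ℂ) * X * cubicInverseNum n := rfl

theorem natDegree_le_and_coeff_ne_zero (n : ℕ) :
    (cubicInverseNum n).natDegree ≤ n ∧ (cubicInverseNum n).coeff n ≠ 0 := by
  induction n with
  | zero => simp [cubicInverseNum]
  | succ n ih =>
    obtain ⟨h1, h2⟩ := ih
    have hd : (derivative (cubicInverseNum n)).natDegree ≤ n - 1 :=
      (natDegree_derivative_le _).trans (by omega)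
    constructor
    · rw [succ_eq]
      refine (natDegree_sub_le_iff_left (n := n + 1) ?_).2 ?_
      · rw [mul_assoc]
        refine (natDegree_C_mul_le _ _).trans (natDegree_mul_le.trans ?_)
        rw [natDegree_X]
        omega
      · rcases Nat.eq_zero_or_pos n with rfl | hn
        · simp [cubicInverseNum]
        · refine natDegree_mul_le.trans ?_
          have : (X ^ 2 - 1 : ℂ[X]).natDegree ≤ 2 := by compute_degree
          omega
    -- The derivative contributes n to the top coefficient and the other term -(4n + 2).
    · have e : (cubicInverseNum (n + 1)).coeff (n + 1)
          = -(3 * n + 2 : ℂ) * (cubicInverseNum n).coeff n := by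
        rw [succ_eq, mul_assoc, coeff_sub, coeff_C_mul, coeff_X_mul, sub_mul, one_mul, coeff_sub,
          coeff_eq_zero_of_natDegree_lt (p := derivative _) (n := n + 1) (by omega)]
        rcases n with _ | n
        · simp [cubicInverseNum]
        · rw [show n + 1 + 1 = n + 2 from rfl, coeff_X_pow_mul, coeff_derivative]
          push_cast
          ring
      rw [e]
      refine mul_ne_zero (neg_ne_zero.2 ?_) h2
      exact_mod_cast (by omega : 3 * n + 2 ≠ 0)

/-- At the critical points of the cubic the derivative term of the recursion disappears, so each
value is a nonzero multiple of the preceding one. -/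
theorem eval_ne_zero_of_sq_eq_one {y : ℂ} (hy : y ^ 2 = 1) (n : ℕ) :
    (cubicInverseNum n).eval y ≠ 0 := by
  induction n with
  | zero => simp [cubicInverseNum]
  | succ n ih =>
    rw [succ_eq]
    simp only [eval_sub, eval_mul, eval_pow, eval_X, eval_one, eval_C, hy, sub_self, zero_mul,
      zero_sub, neg_ne_zero]
    refine mul_ne_zero (mul_ne_zero ?_ ?_) ih
    · exact_mod_cast (by omega : 4 * n + 2 ≠ 0)
    · rintro rfl
      simp at hy

/-- With z = y^3 - 3y, the inverse function g satisfies (z^2 - 4) g'' + z g' - g/9 = 0.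
Differentiating n + 1 times, using z^2 - 4 = (y^2 - 1)^2 (y^2 - 4) and clearing the powers of 3(y^2
- 1) gives this relation. The formal proof is a direct induction. -/
theorem recurrence (n : ℕ) :
    (X ^ 2 - 4) * cubicInverseNum (n + 2)
      + C (3 * (2 * n + 3) : ℂ) * (X ^ 3 - 3 * X) * cubicInverseNum (n + 1)
      + C (9 * (n + 1) ^ 2 - 1 : ℂ) * (X ^ 2 - 1) ^ 2 * cubicInverseNum n = 0 := by
  induction n with
  | zero =>
    simp only [cubicInverseNum, derivative_one, derivative_sub, derivative_mul, derivative_C,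
      derivative_X, derivative_zero]
    simp only [map_add, map_mul, map_sub, map_pow, map_ofNat, map_one,
      map_zero, Nat.cast_zero, Nat.cast_one, zero_add]
    ring
  | succ n ih =>
    have h := congrArg derivative ih
    have e1 := succ_eq n
    have e2 := succ_eq (n + 1)
    have e3 := succ_eq (n + 2)
    rw [show n + 1 + 2 = n + 2 + 1 from rfl, show n + 1 + 1 = n + 2 from rfl]
    rw [show n + 1 + 1 = n + 2 from rfl] at e2
    simp only [derivative_add, derivative_sub, derivative_mul, derivative_pow, derivative_C,
      derivative_X, derivative_zero, derivative_one, derivative_ofNat] at h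
    simp only [map_add, map_mul, map_sub, map_pow, map_ofNat, map_natCast, map_one, Nat.cast_add,
      Nat.cast_one] at h ih e1 e2 e3 ⊢
    generalize derivative (cubicInverseNum n) = a0 at *
    generalize derivative (cubicInverseNum (n + 1)) = a1 at *
    generalize derivative (cubicInverseNum (n + 2)) = a2 at *
    generalize cubicInverseNum n = b0 at *
    generalize cubicInverseNum (n + 1) = b1 at *
    generalize cubicInverseNum (n + 2) = b2 at *
    generalize cubicInverseNum (n + 2 + 1) = b3 at *
    generalize (n : ℂ[X]) = k at *
    -- The operator (X^2 - 1) d/dX - (4n + 6) X, which takes N_(n+1) to N_(n+2), is applied to the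
    -- identity for n.
    linear_combination (X ^ 2 - 1) * h - (4 * k + 6) * X * ih + (X ^ 2 - 4) * e3
      + 3 * (2 * k + 3) * (X ^ 3 - 3 * X) * e2 + (9 * (k + 1) ^ 2 - 1) * (X ^ 2 - 1) ^ 2 * e1

/-- Two consecutive zeros would propagate down the recurrence to N_0 = 1, because its last
coefficient vanishes only where y^2 = 1, which is already excluded. -/
theorem eval_succ_ne_zero {y : ℂ} {n : ℕ} (h : (cubicInverseNum n).eval y = 0) :
    (cubicInverseNum (n + 1)).eval y ≠ 0 := by
  have hy : y ^ 2 - 1 ≠ 0 := fun hy => eval_ne_zero_of_sq_eq_one (sub_eq_zero.1 hy) n h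
  induction n with
  | zero => simp [cubicInverseNum] at h
  | succ n ih =>
    intro h'
    have := congrArg (eval y) (recurrence n)
    simp only [eval_add, eval_mul, h, show n + 2 = n + 1 + 1 from rfl, h', eval_C, eval_pow,
      eval_sub, eval_X, eval_one, eval_zero, mul_zero, zero_add, mul_eq_zero] at this
    refine ih ?_ h
    refine this.resolve_left ?_
    rintro (h9 | h1)
    · have : (9 * (n + 1) ^ 2 : ℕ) = 1 := by exact_mod_cast sub_eq_zero.1 h9
      have : 1 ≤ (n + 1) ^ 2 := Nat.one_le_pow _ _ (by omega)
      omega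
    · exact hy (pow_eq_zero_iff two_ne_zero |>.1 h1)

theorem exists_root {n : ℕ} (hn : n ≠ 0) : ∃ y : ℂ, (cubicInverseNum n).eval y = 0 := by
  refine Complex.exists_root ?_
  exact natDegree_pos_iff_degree_pos.1 ((Nat.pos_of_ne_zero hn).trans_le
    (le_natDegree_of_ne_zero (natDegree_le_and_coeff_ne_zero n).2))

end cubicInverseNum

/-! ### Taylor expansion of the inverse and the choice of the cubic -/

open PowerSeries in
theorem PowerSeries.X_pow_succ_dvd_of_derivative {f : ℂ⟦X⟧} {m : ℕ} (h0 : constantCoeff f = 0)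
    (h : X ^ m ∣ PowerSeries.derivative ℂ f) : X ^ (m + 1) ∣ f := by
  rw [X_pow_dvd_iff] at h ⊢
  intro k hk
  rcases k with _ | k
  · simpa using h0
  · have := h k (by omega)
    rw [coeff_derivative] at this
    exact (mul_eq_zero.1 this).resolve_right (by exact_mod_cast Nat.succ_ne_zero k)

open PowerSeries in
/-- Taylor's formula with respect to the derivation `(d/dX) / Q'`. -/
theorem PowerSeries.X_pow_dvd_sub_taylor {Q : ℂ⟦X⟧} (hQ : constantCoeff Q = 0) {f : ℕ → ℂ⟦X⟧}
    (hf : ∀ k, PowerSeries.derivative ℂ (f k) = PowerSeries.derivative ℂ Q * f (k + 1)) (m k : ℕ) :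
    X ^ m ∣ f k - ∑ j ∈ Finset.range m,
      C (constantCoeff (f (k + j)) / (j.factorial : ℂ)) * Q ^ j := by
  induction m generalizing k with
  | zero => simp
  | succ m ih =>
    refine X_pow_succ_dvd_of_derivative ?_ ?_
    · rw [Finset.sum_range_succ']
      simp [hQ]
    -- Differentiating the remainder of order m + 1 for `f k` gives Q' times the remainder of order
    -- m for `f (k + 1)`.
    · have e : PowerSeries.derivative ℂ (f k - ∑ j ∈ Finset.range (m + 1),
          C (constantCoeff (f (k + j)) / (j.factorial : ℂ)) * Q ^ j)
          = PowerSeries.derivative ℂ Q * (f (k + 1) - ∑ j ∈ Finset.range m,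
          C (constantCoeff (f (k + 1 + j)) / (j.factorial : ℂ)) * Q ^ j) := by
        rw [Finset.sum_range_succ', map_sub, map_add, map_sum, hf, mul_sub, Finset.mul_sum]
        simp only [pow_zero, mul_one, derivative_C, add_zero]
        congr 1
        refine Finset.sum_congr rfl fun j _ => ?_
        rw [Derivation.leibniz, derivative_C, smul_zero, add_zero, derivative_pow, smul_eq_mul,
          Nat.add_sub_cancel, show k + (j + 1) = k + 1 + j by ring]
        have : (C (constantCoeff (f (k + 1 + j)) / ((j + 1).factorial : ℂ)) : ℂ⟦X⟧)
            * ((j + 1 : ℕ) : ℂ⟦X⟧) = C (constantCoeff (f (k + 1 + j)) / (j.factorial : ℂ)) := by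
          rw [← map_natCast (C (R := ℂ)), ← map_mul, Nat.factorial_succ]
          congr 1
          have h1 : ((j + 1 : ℕ) : ℂ) ≠ 0 := by exact_mod_cast Nat.succ_ne_zero j
          have h2 : (j.factorial : ℂ) ≠ 0 := by exact_mod_cast j.factorial_ne_zero
          push_cast at h1 ⊢
          field_simp
        rw [← this]
        ring
      rw [e]
      exact (ih (k + 1)).mul_left _

-- The series `f k` is the k-th derivative of the inverse function with respect to z = y^3 - 3y,
-- written in the local coordinate X at y. The condition on y makes 3(Y^2 - 1) = dz/dY invertible,
-- and the chain rule reproduces the recursion for the numerators.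
open PowerSeries in
theorem cubicInverseNum.exists_taylor {y : ℂ} (hy : y ^ 2 - 1 ≠ 0) :
    ∃ f : ℕ → ℂ⟦X⟧, f 0 = C y + X ∧
      (∀ k, PowerSeries.derivative ℂ (f k) = 3 * ((C y + X) ^ 2 - 1) * f (k + 1)) ∧
      ∀ k, constantCoeff (f (k + 1)) = 0 ↔ (cubicInverseNum k).eval y = 0 := by
  set Y : ℂ⟦X⟧ := C y + X with hY
  have hu0 : constantCoeff (3 * (Y ^ 2 - 1)) ≠ 0 := by
    have h3 : constantCoeff (3 : ℂ⟦X⟧) = 3 := map_ofNat _ 3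
    simpa [hY, h3] using hy
  set u : ℂ⟦X⟧ := (3 * (Y ^ 2 - 1))⁻¹ with hu
  have huY : 3 * (Y ^ 2 - 1) * u = 1 := PowerSeries.mul_inv_cancel _ hu0
  have hdY : PowerSeries.derivative ℂ Y = 1 := by simp [hY]
  have hdu : PowerSeries.derivative ℂ u = - (6 * Y * u ^ 2) := by
    rw [hu, derivative_inv', ← hu]
    have : PowerSeries.derivative ℂ (3 * (Y ^ 2 - 1)) = 6 * Y := by
      have h3 : (3 : ℂ⟦X⟧) = C 3 := (map_ofNat _ 3).symm
      rw [Derivation.leibniz, map_sub, derivative_pow, hdY, h3, derivative_C, ← h3]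
      simp
      ring
    rw [this]
    ring
  refine ⟨fun k => k.casesOn Y fun k => C (3 ^ k) * Polynomial.aeval Y (cubicInverseNum k)
    * u ^ (2 * k + 1), rfl, ?_, ?_⟩
  · rintro (_ | k)
    · simp [cubicInverseNum, hdY, huY]
    · have hM : PowerSeries.derivative ℂ (Polynomial.aeval Y (cubicInverseNum k))
          = Polynomial.aeval Y (Polynomial.derivative (cubicInverseNum k)) := by
        rw [Derivation.comp_aeval_eq, hdY, smul_eq_mul, mul_one]
      have e : Polynomial.aeval Y (cubicInverseNum (k + 1))
          = (Y ^ 2 - 1) * Polynomial.aeval Y (Polynomial.derivative (cubicInverseNum k))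
            - (4 * k + 2) * Y * Polynomial.aeval Y (cubicInverseNum k) := by
        simp only [cubicInverseNum.succ_eq, map_sub, map_mul, map_pow, map_one, Polynomial.aeval_X,
          map_add, map_ofNat, map_natCast]
      simp only [Derivation.leibniz, derivative_C, derivative_pow, hM, hdu, smul_eq_mul, e]
      simp only [map_pow, map_ofNat]
      rw [show 2 * k + 1 - 1 = 2 * k by omega, show 2 * (k + 1) + 1 = 2 * k + 3 by ring]
      push_cast
      generalize Polynomial.aeval Y (Polynomial.derivative (cubicInverseNum k)) = D
      generalize Polynomial.aeval Y (cubicInverseNum k) = M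
      rw [pow_succ _ (2 * k), pow_add _ (2 * k) 3]
      linear_combination (-3 ^ k * (u ^ (2 * k)) * ((3 * (Y ^ 2 - 1) * D * u ^ 2) - (3 * (4 * k + 2) * Y * M * u ^ 2) + D * u)) * huY
  · intro k
    have h1 : constantCoeff u ≠ 0 := by
      intro h
      have := congrArg constantCoeff huY
      rw [map_mul, h] at this
      simp at this
    have h2 : constantCoeff (Polynomial.aeval Y (cubicInverseNum k))
        = (cubicInverseNum k).eval y := by
      rw [Polynomial.aeval_def, Polynomial.hom_eval₂]
      simp [hY, Polynomial.eval₂_eq_eval_map]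
    simp [h1, h2]

open Polynomial in
/-- Up to order `d + 2`, some cubic polynomial has a left inverse of degree at most `d`. -/
theorem Polynomial.exists_comp_cubic_eq {d : ℕ} (hd : d ≠ 0) :
    ∃ (p q S : ℂ[X]) (r : ℂ), r ≠ 0 ∧ q.natDegree = 2 ∧ q.eval 0 ≠ 0 ∧ p.natDegree ≤ d ∧
      p.comp (X * q) = X + C r * X ^ (d + 2) + X ^ (d + 3) * S := by
  obtain ⟨y, hy⟩ := cubicInverseNum.exists_root hd
  have hy' := cubicInverseNum.eval_succ_ne_zero hy
  have hy1 : y ^ 2 - 1 ≠ 0 := fun h =>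
    cubicInverseNum.eval_ne_zero_of_sq_eq_one (sub_eq_zero.1 h) d hy
  obtain ⟨f, hf0, hf, hc⟩ := cubicInverseNum.exists_taylor hy1
  -- Here X q is (y + X)^3 - 3(y + X) minus its value at X = 0.
  set q : ℂ[X] := C (3 * (y ^ 2 - 1)) + C (3 * y) * X + X ^ 2 with hq
  have hq0 : q.eval 0 ≠ 0 := by simpa [hq] using hy1
  have hQ' : PowerSeries.derivative ℂ ((X * q : ℂ[X]) : PowerSeries ℂ)
      = 3 * ((PowerSeries.C y + PowerSeries.X) ^ 2 - 1) := by
    rw [PowerSeries.derivative_coe]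
    have : derivative (X * q) = 3 * ((C y + X) ^ 2 - 1) := by
      simp only [hq, derivative_mul, derivative_add, derivative_X, derivative_C, derivative_X_pow]
      push_cast
      simp only [map_mul, map_sub, map_pow, map_ofNat, map_one]
      ring
    rw [this]
    have h3 : ((3 : ℂ[X]) : PowerSeries ℂ) = 3 := map_ofNat (Polynomial.coeToPowerSeries.ringHom) 3
    simp [h3]
  have hT := PowerSeries.X_pow_dvd_sub_taylor (Q := ((X * q : ℂ[X]) : PowerSeries ℂ)) (f := f) (by simp)
    (fun k => by rw [hQ', hf]) (d + 3) 0
  set c : ℕ → ℂ := fun j => PowerSeries.constantCoeff (f (0 + j)) / (j.factorial : ℂ) with hcdef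
  have hc0 : c 0 = y := by simp [hcdef, hf0]
  -- The shift matters: the Taylor coefficient of index k + 1 is governed by N_k.
  have hc1 : c (d + 1) = 0 := by simp [hcdef, (hc d).2 hy]
  have hc2 : c (d + 2) ≠ 0 := by
    simp only [hcdef, zero_add]
    exact div_ne_zero (mt (hc (d + 1)).1 hy') (by exact_mod_cast (d + 2).factorial_ne_zero)
  set p : ℂ[X] := ∑ j ∈ Finset.range d, C (c (j + 1)) * X ^ (j + 1) with hp
  -- In the Taylor expansion of y + X in powers of X q, the constant term y cancels and the term of
  -- index d + 1 vanishes.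
  have hpoly : (X : ℂ[X]) ^ (d + 3) ∣
      X - p.comp (X * q) - C (c (d + 2)) * (X * q) ^ (d + 2) := by
    have e : ((X - p.comp (X * q) - C (c (d + 2)) * (X * q) ^ (d + 2) : ℂ[X]) : PowerSeries ℂ)
        = f 0 - ∑ j ∈ Finset.range (d + 3), PowerSeries.C (c j) *
          ((X * q : ℂ[X]) : PowerSeries ℂ) ^ j := by
      rw [Finset.sum_range_succ, Finset.sum_range_succ, Finset.sum_range_succ', hf0, hc0, hc1, hp]
      have : ((∑ j ∈ Finset.range d, C (c (j + 1)) * X ^ (j + 1) : ℂ[X]).comp (X * q))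
          = ∑ j ∈ Finset.range d, C (c (j + 1)) * (X * q) ^ (j + 1) := by
        simp
      rw [this]
      have hs : ((∑ j ∈ Finset.range d, C (c (j + 1)) * (X * q) ^ (j + 1) : ℂ[X]) : PowerSeries ℂ)
          = ∑ j ∈ Finset.range d, PowerSeries.C (c (j + 1)) *
            ((X * q : ℂ[X]) : PowerSeries ℂ) ^ (j + 1) := by
        rw [← Polynomial.coeToPowerSeries.ringHom_apply, map_sum]
        simp
      rw [Polynomial.coe_sub, Polynomial.coe_sub, hs]
      simp only [Polynomial.coe_mul, Polynomial.coe_pow, Polynomial.coe_C, Polynomial.coe_X,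
        map_zero]
      ring
    rw [X_pow_dvd_iff]
    intro k hk
    rw [← e, PowerSeries.X_pow_dvd_iff] at hT
    simpa only [Polynomial.coeff_coe] using hT k hk
  have hq1 : (X : ℂ[X]) ∣ q ^ (d + 2) - C (q.eval 0 ^ (d + 2)) := by
    rw [X_dvd_iff, coeff_zero_eq_eval_zero]
    simp
  rw [mul_pow] at hpoly
  obtain ⟨A, hA⟩ := hpoly
  obtain ⟨B, hB⟩ := hq1
  refine ⟨p, q, -A - C (c (d + 2)) * B, -(c (d + 2) * q.eval 0 ^ (d + 2)), ?_, ?_, hq0, ?_, ?_⟩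
  · exact neg_ne_zero.2 (mul_ne_zero hc2 (pow_ne_zero _ hq0))
  · rw [hq]
    compute_degree!
  · refine natDegree_sum_le_of_forall_le _ _ fun j hj => ?_
    refine (natDegree_C_mul_X_pow_le _ _).trans ?_
    simpa [Nat.succ_le_iff] using hj
  · clear_value q
    rw [map_neg, map_mul]
    linear_combination -hA - C (c (d + 2)) * X ^ (d + 2) * hB

/-! ### Degrees, triangular automorphisms and reduced products -/

theorem MvPolynomial.totalDegree_aeval_le {K σ τ : Type*} [Field K] [Fintype σ] {N : ℕ}
    {f : σ → MvPolynomial τ K} (hf : ∀ i, (f i).totalDegree ≤ N) (p : MvPolynomial σ K) :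
    (MvPolynomial.aeval f p).totalDegree ≤ p.totalDegree * N := by
  rw [MvPolynomial.aeval_def, MvPolynomial.eval₂_eq']
  refine MvPolynomial.totalDegree_finsetSum_le fun m hm => ?_
  refine (MvPolynomial.totalDegree_mul _ _).trans ?_
  rw [MvPolynomial.algebraMap_eq, MvPolynomial.totalDegree_C, zero_add]
  refine (MvPolynomial.totalDegree_finsetProd _ _).trans ?_
  calc ∑ i, (f i ^ m i).totalDegree ≤ ∑ i, m i * N :=
        Finset.sum_le_sum fun i _ => (MvPolynomial.totalDegree_pow _ _).trans
          (Nat.mul_le_mul_left _ (hf i))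
    _ = (m.sum fun _ e => e) * N := by
        rw [← Finset.sum_mul, Finsupp.sum_fintype _ _ fun _ => rfl]
    _ ≤ p.totalDegree * N := Nat.mul_le_mul_right _ (MvPolynomial.le_totalDegree hm)

namespace PlaneAut

@[ext]
theorem ext {K : Type*} [Field K] {θ σ : PlaneAut K} (h : ∀ i, θ.component i = σ.component i) :
    θ = σ := by
  refine MulOpposite.unop_injective (AlgEquiv.coe_toAlgHom_injective ?_)
  exact MvPolynomial.algHom_ext h

theorem IsAffine.mul {K : Type*} [Field K] {θ σ : PlaneAut K} (hθ : θ.IsAffine)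
    (hσ : σ.IsAffine) : (θ * σ).IsAffine := by
  have h (i : Fin 2) : ((θ * σ).component i).totalDegree ≤ (θ.component i).totalDegree * 1 := by
    rw [component_mul]
    refine MvPolynomial.totalDegree_aeval_le (fun j => ?_) _
    obtain ⟨h0, h1⟩ := max_le_iff.1 hσ
    fin_cases j
    exacts [h0, h1]
  simp only [mul_one] at h
  exact (max_le_max (h 0) (h 1)).trans hθ

open MvPolynomial in
/-- The triangular automorphism `(a X + P(Y), b Y + c)`. -/
noncomputable def triangular {K : Type*} [Field K] (a b c : K) (P : Polynomial K) (ha : a ≠ 0)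
    (hb : b ≠ 0) : PlaneAut K :=
  MulOpposite.op <| AlgEquiv.ofAlgHom
    (aeval ![C a * X 0 + Polynomial.aeval (X 1) P, C b * X 1 + C c])
    (aeval ![C a⁻¹ * (X 0 - Polynomial.aeval (C b⁻¹ * (X 1 - C c)) P), C b⁻¹ * (X 1 - C c)])
    (by
      have h1 : (C b⁻¹ * C b : MvPolynomial (Fin 2) K) = 1 := by
        rw [← map_mul, inv_mul_cancel₀ hb, map_one]
      have h2 : (C a⁻¹ * C a : MvPolynomial (Fin 2) K) = 1 := by
        rw [← map_mul, inv_mul_cancel₀ ha, map_one]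
      have e : C b⁻¹ * (C b * X 1 + C c - C c) = (X 1 : MvPolynomial (Fin 2) K) := by
        linear_combination X 1 * h1
      ext1 i
      fin_cases i
      · simp only [Fin.zero_eta, AlgHom.coe_comp, Function.comp_apply, aeval_X,
          Matrix.cons_val_zero, map_mul, map_sub, AlgHom.id_apply, ← Polynomial.aeval_algHom_apply,
          Matrix.cons_val_one, algHom_C, algebraMap_eq, e]
        linear_combination X 0 * h2
      · simpa [algHom_C, algebraMap_eq] using e)
    (by
      have h1 : (C b * C b⁻¹ : MvPolynomial (Fin 2) K) = 1 := by
        rw [← map_mul, mul_inv_cancel₀ hb, map_one]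
      have h2 : (C a * C a⁻¹ : MvPolynomial (Fin 2) K) = 1 := by
        rw [← map_mul, mul_inv_cancel₀ ha, map_one]
      ext1 i
      fin_cases i
      · simp only [Fin.zero_eta, AlgHom.coe_comp, Function.comp_apply, aeval_X,
          Matrix.cons_val_zero, map_mul, map_add, AlgHom.id_apply, ← Polynomial.aeval_algHom_apply,
          Matrix.cons_val_one, algHom_C, algebraMap_eq]
        linear_combination (X 0 - Polynomial.aeval (C b⁻¹ * (X 1 - C c)) P) * h2
      · simp only [Fin.mk_one, AlgHom.coe_comp, Function.comp_apply, aeval_X,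
          Matrix.cons_val_one, Matrix.cons_val_fin_one, map_mul, map_add, AlgHom.id_apply,
          algHom_C, algebraMap_eq]
        linear_combination (X 1 - C c) * h1)

section

variable {K : Type*} [Field K] {a b : K} (c : K) (P : Polynomial K) (ha : a ≠ 0) (hb : b ≠ 0)

@[simp]
theorem component_triangular_zero :
    (triangular a b c P ha hb).component 0 = MvPolynomial.C a * MvPolynomial.X 0
      + Polynomial.aeval (MvPolynomial.X 1) P := by
  simp [component, comorphism, triangular]

@[simp]
theorem component_triangular_one :
    (triangular a b c P ha hb).component 1 = MvPolynomial.C b * MvPolynomial.X 1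
      + MvPolynomial.C c := by
  simp [component, comorphism, triangular]

theorem isTriangular_triangular : (triangular a b c P ha hb).IsTriangular :=
  ⟨a, b, c, P, ha, hb, component_triangular_zero c P ha hb, component_triangular_one c P ha hb⟩

end

/-- The automorphism `(Y, X)`. -/
noncomputable def swap (K : Type*) [Field K] : PlaneAut K :=
  MulOpposite.op <| MvPolynomial.renameEquiv K (Equiv.swap 0 1)

@[simp]
theorem component_swap_zero (K : Type*) [Field K] :
    (swap K).component 0 = MvPolynomial.X 1 := by
  simp [component, comorphism, swap]

@[simp]
theorem component_swap_one (K : Type*) [Field K] :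
    (swap K).component 1 = MvPolynomial.X 0 := by
  simp [component, comorphism, swap]

theorem isAffine_swap (K : Type*) [Field K] : (swap K).IsAffine := by
  simp [IsAffine, degree]

open MvPolynomial in
theorem not_isTriangular_swap (K : Type*) [Field K] : ¬ (swap K).IsTriangular := by
  rintro ⟨a, b, c, P, ha, hb, -, h⟩
  rw [component_swap_one] at h
  have h0 := congrArg (MvPolynomial.eval ![0, 0]) h
  have h1 := congrArg (MvPolynomial.eval ![1, 0]) h
  simp at h0 h1
  exact one_ne_zero (h1.trans h0.symm)

section degree

variable {K : Type*} [Field K] {θ : PlaneAut K} {a b c : K} {P : Polynomial K}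

open MvPolynomial in
theorem degree_le_of_component_eq
    (h0 : θ.component 0 = C a * X 0 + Polynomial.aeval (X 1 : MvPolynomial (Fin 2) K) P)
    (h1 : θ.component 1 = C b * X 1 + C c) : θ.degree ≤ max 1 P.natDegree := by
  have hX (u : K) (i : Fin 2) : (C u * X i : MvPolynomial (Fin 2) K).totalDegree ≤ 1 := by
    refine (totalDegree_mul _ _).trans ?_
    simp
  refine max_le ?_ ?_
  · rw [h0]
    refine (totalDegree_add _ _).trans (max_le_max (hX a 0) ?_)
    rw [Polynomial.aeval_eq_sum_range]
    refine totalDegree_finsetSum_le fun i hi => ?_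
    refine (totalDegree_smul_le _ _).trans ?_
    rw [totalDegree_X_pow]
    exact Nat.lt_succ_iff.1 (Finset.mem_range.1 hi)
  · rw [h1]
    refine (totalDegree_add _ _).trans (le_max_of_le_left (max_le (hX b 1) ?_))
    simp

open MvPolynomial in
theorem natDegree_le_degree
    (h0 : θ.component 0 = C a * X 0 + Polynomial.aeval (X 1 : MvPolynomial (Fin 2) K) P) :
    P.natDegree ≤ θ.degree := by
  rcases eq_or_ne P 0 with rfl | hP
  · simp
  have hc : (θ.component 0).coeff (Finsupp.single 1 P.natDegree) = P.leadingCoeff := by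
    rw [h0, coeff_add, coeff_C_mul, coeff_X, if_neg, mul_zero, zero_add,
      Polynomial.aeval_eq_sum_range, coeff_sum, Finset.sum_eq_single P.natDegree]
    · simp [coeff_X_pow]
    · intro j _ hj
      rw [coeff_smul, coeff_X_pow, if_neg, smul_zero]
      intro h
      exact hj (Finsupp.single_injective _ h)
    · simp
    · intro h
      simpa using DFunLike.congr_fun h 0
  have := le_totalDegree (p := θ.component 0) (s := Finsupp.single 1 P.natDegree)
    (by rw [mem_support_iff, hc]; simpa using hP)
  rw [Finsupp.sum_single_index rfl] at this
  exact this.trans (le_max_left _ _)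

theorem degree_triangular (ha : a ≠ 0) (hb : b ≠ 0) (hP : P.natDegree ≠ 0) :
    (triangular a b c P ha hb).degree = P.natDegree := by
  refine le_antisymm ((degree_le_of_component_eq (component_triangular_zero _ _ _ _)
    (component_triangular_one _ _ _ _)).trans ?_)
    (natDegree_le_degree (component_triangular_zero _ _ _ _))
  omega

theorem isAffine_triangular (ha : a ≠ 0) (hb : b ≠ 0) (hP : P.natDegree ≤ 1) :
    (triangular a b c P ha hb).IsAffine :=
  (degree_le_of_component_eq (component_triangular_zero _ _ _ _)
    (component_triangular_one _ _ _ _)).trans (by omega)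

end degree

theorem hasPolydegree_pair {K : Type*} [Field K] {d e : ℕ} (hd : 2 ≤ d) (he : 2 ≤ e)
    {α₀ α₁ α₂ τ₁ τ₂ : PlaneAut K} (h₀ : α₀.IsAffine) (h₁ : α₁.IsAffine) (h₂ : α₂.IsAffine)
    (h₁' : ¬ α₁.IsTriangular) (ht₁ : τ₁.IsTriangular) (ht₂ : τ₂.IsTriangular)
    (hd₁ : τ₁.degree = d) (hd₂ : τ₂.degree = e) :
    (α₀ * (τ₁ * α₁ * τ₂) * α₂).HasPolydegree [d, e] := by
  refine ⟨![α₀, α₁, α₂], ![τ₁, τ₂], ?_, ?_, ?_, ?_, ?_⟩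
  · intro i
    fin_cases i
    exacts [h₀, h₁, h₂]
  · intro i hi hi'
    fin_cases i
    exacts [absurd rfl hi, h₁', absurd rfl hi']
  · intro i
    fin_cases i
    exacts [⟨ht₁, fun h => by have : τ₁.degree ≤ 1 := h; omega⟩,
      ⟨ht₂, fun h => by have : τ₂.degree ≤ 1 := h; omega⟩]
  · intro i
    fin_cases i
    exacts [hd₁, hd₂]
  · change _ = α₀ * (List.ofFn fun i : Fin 2 => _).prod
    simp [List.ofFn_succ, mul_assoc]

theorem HasPolydegree.exists_singleton {K : Type*} [Field K] {d : ℕ} {θ : PlaneAut K}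
    (h : θ.HasPolydegree [d]) : ∃ α τ β : PlaneAut K, α.IsAffine ∧ β.IsAffine ∧ τ.IsTriangular ∧
      τ.degree = d ∧ θ = α * τ * β := by
  obtain ⟨α, τ, hα, -, hτ, hd, h⟩ := h
  refine ⟨α 0, τ 0, α 1, hα _, hα _, (hτ _).1, hd 0, ?_⟩
  rw [h, mul_assoc]
  change _ * (List.ofFn fun i : Fin 1 => _).prod = _
  simp [List.ofFn_succ]

end PlaneAut

/-! ### Polynomial families and their limits -/

/-- Specialization of the parameter of a family of polynomials at `t`. -/
noncomputable def MvPolynomial.specialize {σ : Type*} (t : ℂ) :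
    MvPolynomial σ (Polynomial ℂ) →ₐ[ℂ] MvPolynomial σ ℂ :=
  MvPolynomial.mapAlgHom (Polynomial.aeval t)

namespace MvPolynomial

variable {σ : Type*} (t : ℂ)

@[simp]
theorem specialize_X (i : σ) : specialize t (X i) = X i := by
  simp [specialize]

@[simp]
theorem specialize_C (p : Polynomial ℂ) :
    specialize t (C p : MvPolynomial σ (Polynomial ℂ)) = C (p.eval t) := by
  simp [specialize]

theorem coeff_specialize (G : MvPolynomial σ (Polynomial ℂ)) (m : σ →₀ ℕ) :
    (specialize t G).coeff m = (G.coeff m).eval t := by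
  simp [specialize, coeff_map]

theorem specialize_map_C (p : MvPolynomial σ ℂ) :
    specialize t (map Polynomial.C p) = p := by
  ext m
  rw [coeff_specialize, coeff_map, Polynomial.eval_C]

theorem totalDegree_specialize_le (G : MvPolynomial σ (Polynomial ℂ)) :
    (specialize t G).totalDegree ≤ G.totalDegree := by
  refine Finset.sup_mono fun m hm => ?_
  rw [mem_support_iff, coeff_specialize] at hm
  rw [mem_support_iff]
  rintro h
  simp [h] at hm

theorem specialize_aeval {τ : Type*} (g : σ → MvPolynomial τ (Polynomial ℂ))
    (G : MvPolynomial σ (Polynomial ℂ)) :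
    specialize t (aeval g G) = aeval (fun i => specialize t (g i)) (specialize t G) := by
  induction G using MvPolynomial.induction_on with
  | C a => simp [algHom_C, algebraMap_eq]
  | add p q hp hq => simp only [map_add, hp, hq]
  | mul_X p i hp => simp only [map_mul, hp, aeval_X, specialize_X]

end MvPolynomial

namespace PlaneAut

open MvPolynomial

/-- `θ` is the value at `t = 0` of a polynomial family that lies in `S` for infinitely many `t`. -/
def IsPolynomialLimit (S : Set (PlaneAut ℂ)) (θ : PlaneAut ℂ) : Prop :=
  ∃ G : Fin 2 → MvPolynomial (Fin 2) (Polynomial ℂ),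
    (∀ i, θ.component i = specialize 0 (G i)) ∧
    {t : ℂ | ∃ σ ∈ S, ∀ i, σ.component i = specialize t (G i)}.Infinite

/-- The degree of the family bounds that of all its members, so a single level of the ind-variety
suffices. There each equation of a closed set containing S restricts to a polynomial in t with
infinitely many roots; it is therefore zero, in particular at t = 0. -/
theorem IsPolynomialLimit.mem_closure {S : Set (PlaneAut ℂ)} {θ : PlaneAut ℂ}
    (h : IsPolynomialLimit S θ) : θ ∈ closure S := by
  obtain ⟨G, hG, hinf⟩ := h
  refine Set.mem_sInter.2 ?_
  rintro T ⟨hT, hST⟩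
  rw [isClosed_iff] at hT
  obtain ⟨I, hI⟩ := hT (max (G 0).totalDegree (G 1).totalDegree)
  have hdeg (σ : PlaneAut ℂ) (t : ℂ) (hσ : ∀ i, σ.component i = specialize t (G i)) :
      σ.degree ≤ max (G 0).totalDegree (G 1).totalDegree := by
    rw [degree, hσ, hσ]
    exact max_le_max (totalDegree_specialize_le _ _) (totalDegree_specialize_le _ _)
  set g : Fin 2 × (Fin 2 →₀ ℕ) → Polynomial ℂ := fun q => (G q.1).coeff q.2 with hg
  have heval (σ : PlaneAut ℂ) (t : ℂ) (hσ : ∀ i, σ.component i = specialize t (G i))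
      (p : MvPolynomial (Fin 2 × (Fin 2 →₀ ℕ)) ℂ) : eval σ.coords p = (aeval g p).eval t := by
    have : σ.coords = fun q => Polynomial.aeval t (g q) := by
      funext q
      rw [coords, hσ, coeff_specialize, Polynomial.coe_aeval_eq_eval]
    rw [this, ← Polynomial.coe_aeval_eq_eval, MvPolynomial.comp_aeval_apply,
      MvPolynomial.aeval_eq_eval]
  refine (hI θ (hdeg θ 0 hG)).2 fun p hp => ?_
  have hzero : aeval g p = 0 := by
    refine Polynomial.eq_zero_of_infinite_isRoot _ (hinf.mono ?_)
    rintro t ⟨σ, hσS, hσ⟩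
    change (aeval g p).eval t = 0
    rw [← heval σ t hσ]
    exact (hI σ (hdeg σ t hσ)).1 (hST hσS) p hp
  rw [heval θ 0 hG, hzero, Polynomial.eval_zero]

theorem IsPolynomialLimit.mul_mul {S T : Set (PlaneAut ℂ)} {θ : PlaneAut ℂ}
    (h : IsPolynomialLimit S θ) {α β : PlaneAut ℂ} (hST : ∀ σ ∈ S, α * σ * β ∈ T) :
    IsPolynomialLimit T (α * θ * β) := by
  obtain ⟨G, hG, hinf⟩ := h
  have key (σ : PlaneAut ℂ) (t : ℂ) (hσ : ∀ i, σ.component i = specialize t (G i)) (i : Fin 2) :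
      (α * σ * β).component i
        = specialize t (aeval (fun j => map Polynomial.C (β.component j))
          (aeval G (α.component i))) := by
    rw [specialize_aeval, comp_aeval_apply, component_mul, component_mul]
    simp only [specialize_map_C, ← hσ]
  refine ⟨_, fun i => key θ 0 hG i, hinf.mono ?_⟩
  rintro t ⟨σ, hσS, hσ⟩
  exact ⟨_, hST σ hσS, key σ t hσ⟩

end PlaneAut

/-! ### The degeneration of polydegree (d, 3) -/

namespace PlaneAut

-- The pole of t^(-(d+2)) p(tU) at t = 0 is exactly t^(-(d+1)) Y, and the linear part of the first
-- factor removes it. The free polynomial L later supplies the terms of degree at most d.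
open MvPolynomial in
theorem isPolynomialLimit_triangular {d : ℕ} (hd : 2 ≤ d) {p q S L : Polynomial ℂ} {r : ℂ}
    (hq : q.natDegree = 2) (hq0 : q.eval 0 ≠ 0) (hp : p.natDegree ≤ d) (hL : L.natDegree ≤ d)
    (h : p.comp (Polynomial.X * q) = Polynomial.X + Polynomial.C r * Polynomial.X ^ (d + 2)
      + Polynomial.X ^ (d + 3) * S) (hp0 : -p.derivative.eval 0 ≠ 0) :
    IsPolynomialLimit
      {σ | ∃ τ₁ τ₂ : PlaneAut ℂ, τ₁.IsTriangular ∧ τ₂.IsTriangular ∧ τ₁.degree = d ∧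
        τ₂.degree = 3 ∧ σ = τ₁ * swap ℂ * τ₂}
      (triangular (-p.derivative.eval 0) (q.eval 0) 0
        (-(Polynomial.C r * Polynomial.X ^ (d + 2)
          + L.comp (Polynomial.C (q.eval 0) * Polynomial.X))) hp0 hq0) := by
  set s : MvPolynomial (Fin 2) (Polynomial ℂ) := C Polynomial.X with hs
  set x : MvPolynomial (Fin 2) (Polynomial ℂ) := X 0 with hx
  set y : MvPolynomial (Fin 2) (Polynomial ℂ) := X 1 with hy
  set U := s ^ (d + 1) * x + y * Polynomial.aeval (s * y) q with hU
  set v := s * y * Polynomial.aeval (s * y) q with hv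
  have hv' : Polynomial.aeval v p = s * y + C (Polynomial.C r) * (s * y) ^ (d + 2)
      + (s * y) ^ (d + 3) * Polynomial.aeval (s * y) S := by
    have h1 := congrArg (Polynomial.aeval (s * y)) h
    rw [Polynomial.aeval_comp] at h1
    simpa [← hv, algebraMap_eq] using h1
  obtain ⟨K, hK⟩ : ∃ K, Polynomial.aeval (s * U) p = Polynomial.aeval v p
      + Polynomial.aeval v p.derivative * (s ^ (d + 2) * x) + K * (s ^ (d + 2) * x) ^ 2 := by
    obtain ⟨K, hK⟩ := (p.map (algebraMap ℂ (MvPolynomial (Fin 2) (Polynomial ℂ)))).binomExpansion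
      v (s ^ (d + 2) * x)
    refine ⟨K, ?_⟩
    rw [Polynomial.derivative_map] at hK
    simp only [Polynomial.eval_map_algebraMap] at hK
    rw [← hK, hU, hv]
    refine congrArg (fun z => Polynomial.aeval z p) ?_
    ring
  set V := -(C (Polynomial.C r) * y ^ (d + 2) + s * y ^ (d + 3) * Polynomial.aeval (s * y) S
    + x * Polynomial.aeval v p.derivative + s ^ (d + 2) * x ^ 2 * K + Polynomial.aeval U L
    + s * U ^ d) with hV
  have hVU : s ^ (d + 2) * V = s * y - Polynomial.aeval (s * U) p
      - s ^ (d + 2) * Polynomial.aeval U L - s ^ (d + 3) * U ^ d := by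
    rw [hK, hv', hV]
    ring
  have hsp (t : ℂ) (z : MvPolynomial (Fin 2) (Polynomial ℂ)) (P : Polynomial ℂ) :
      specialize t (Polynomial.aeval z P) = Polynomial.aeval (specialize t z) P :=
    (Polynomial.aeval_algHom_apply _ _ _).symm
  have hst (t : ℂ) : specialize t s = C t := by simp [hs]
  have hxt (t : ℂ) : specialize t x = X 0 := specialize_X t 0
  have hyt (t : ℂ) : specialize t y = X 1 := specialize_X t 1
  clear_value s x y
  refine ⟨![V, U], ?_, ?_⟩
  · have hU0 : specialize 0 U = C (q.eval 0) * X 1 := by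
      simp [hU, hst, hyt, Polynomial.aeval_def, ← Polynomial.coeff_zero_eq_eval_zero,
        algebraMap_eq, mul_comm]
    have hv0 : specialize 0 v = 0 := by simp [hv, hst]
    intro i
    fin_cases i
    · change (triangular _ _ _ _ _ _).component 0 = specialize 0 V
      rw [component_triangular_zero, hV]
      simp [hsp, hU0, hv0, hst, hxt, hyt, Polynomial.aeval_comp, algebraMap_eq,
        ← Polynomial.coeff_zero_eq_aeval_zero', ← Polynomial.coeff_zero_eq_eval_zero]
      rw [mul_comm (X 0)]
      abel
    · change (triangular _ _ _ _ _ _).component 1 = specialize 0 U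
      rw [component_triangular_one, hU0]
      simp
  -- The cubic expression is -t^2 times the coefficient of degree d in `P₁`. Its t^3 comes from the
  -- extra term t U^d, so it is a nonzero polynomial whatever p and L are.
  · have hfin : {t : ℂ | t = 0 ∨ p.coeff d + L.coeff d * t ^ 2 + t ^ 3 = 0}.Finite := by
      have hne : (Polynomial.X * (Polynomial.C (p.coeff d)
          + Polynomial.C (L.coeff d) * Polynomial.X ^ 2 + Polynomial.X ^ 3) : Polynomial ℂ) ≠ 0 := by
        refine mul_ne_zero Polynomial.X_ne_zero fun h0 => ?_
        have := congrArg (Polynomial.coeff · 3) h0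
        simp [Polynomial.coeff_X_pow] at this
      refine (Polynomial.finite_setOfPred_isRoot hne).subset ?_
      intro t ht
      simpa [Polynomial.IsRoot] using ht
    refine hfin.infinite_compl.mono fun t ht => ?_
    simp only [Set.mem_compl_iff, Set.mem_ofPred_eq, not_or] at ht
    obtain ⟨ht0, ht1⟩ := ht
    have hCt : (C t⁻¹ * C t : MvPolynomial (Fin 2) ℂ) = 1 := by
      rw [← map_mul, inv_mul_cancel₀ ht0, map_one]
    set P₁ : Polynomial ℂ := -(Polynomial.C (t⁻¹ ^ (d + 2))
      * p.comp (Polynomial.C t * Polynomial.X) + L + Polynomial.C t * Polynomial.X ^ d) with hP₁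
    set P₂ : Polynomial ℂ := Polynomial.X * q.comp (Polynomial.C t * Polynomial.X) with hP₂
    have hlin : (Polynomial.C t * Polynomial.X : Polynomial ℂ).natDegree = 1 :=
      Polynomial.natDegree_C_mul_X t ht0
    have hdeg₁ : P₁.natDegree = d := by
      refine Polynomial.natDegree_eq_of_le_of_coeff_ne_zero ?_ ?_
      · rw [hP₁, Polynomial.natDegree_neg]
        refine Polynomial.natDegree_add_le_of_degree_le (Polynomial.natDegree_add_le_of_degree_le
          ((Polynomial.natDegree_C_mul_le _ _).trans ?_) hL)
          (Polynomial.natDegree_C_mul_X_pow_le _ _)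
        rwa [Polynomial.natDegree_comp, hlin, mul_one]
      · intro h0
        apply ht1
        rw [hP₁] at h0
        simp only [Polynomial.coeff_neg, Polynomial.coeff_add, Polynomial.coeff_C_mul,
          Polynomial.comp_C_mul_X_coeff, Polynomial.coeff_X_pow_self, mul_one, neg_eq_zero] at h0
        have e : t⁻¹ ^ (d + 2) * t ^ (d + 2) = 1 := by
          rw [← mul_pow, inv_mul_cancel₀ ht0, one_pow]
        linear_combination t ^ 2 * h0 - p.coeff d * e
    have hdeg₂ : P₂.natDegree = 3 := by
      have hne : q.comp (Polynomial.C t * Polynomial.X) ≠ 0 := by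
        intro h0
        have := congrArg Polynomial.natDegree h0
        rw [Polynomial.natDegree_comp, hlin, hq] at this
        simp at this
      rw [hP₂, Polynomial.natDegree_X_mul hne, Polynomial.natDegree_comp, hlin, hq]
    have hUt : specialize t U = C (t ^ (d + 1)) * X 0 + Polynomial.aeval (X 1) P₂ := by
      simp [hU, hsp, hst, hxt, hyt, hP₂, Polynomial.aeval_comp, algebraMap_eq]
    refine ⟨_, ⟨triangular (t⁻¹ ^ (d + 1)) 1 0 P₁ (pow_ne_zero _ (inv_ne_zero ht0)) one_ne_zero,
      triangular (t ^ (d + 1)) 1 0 P₂ (pow_ne_zero _ ht0) one_ne_zero,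
      isTriangular_triangular _ _ _ _, isTriangular_triangular _ _ _ _, ?_, ?_, rfl⟩, ?_⟩
    · rw [degree_triangular _ _ (by omega), hdeg₁]
    · rw [degree_triangular _ _ (by omega), hdeg₂]
    · intro i
      rw [mul_assoc, component_mul]
      have h0 : (swap ℂ * triangular (t ^ (d + 1)) 1 0 P₂ (pow_ne_zero _ ht0)
          one_ne_zero).component 0 = X 1 := by
        simp [component_mul]
      have h1 : (swap ℂ * triangular (t ^ (d + 1)) 1 0 P₂ (pow_ne_zero _ ht0)
          one_ne_zero).component 1 = specialize t U := by
        simp [component_mul, hUt]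
      fin_cases i
      · change _ = specialize t V
        have hVt := congrArg (specialize t) hVU
        simp only [map_mul, map_sub, map_pow, hsp, hst, hyt] at hVt
        simp only [Fin.zero_eta, component_triangular_zero, map_add, map_mul, algHom_C, aeval_X,
          h0, ← Polynomial.aeval_algHom_apply, h1, algebraMap_eq, hP₁, map_neg,
          Polynomial.aeval_comp, Polynomial.aeval_C, Polynomial.aeval_X, map_pow]
        have e (n : ℕ) : (C t⁻¹ ^ n * C t ^ n : MvPolynomial (Fin 2) ℂ) = 1 := by
          rw [← mul_pow, hCt, one_pow]
        have e' : (C t⁻¹ ^ (d + 2) * C t  : MvPolynomial (Fin 2) ℂ) = C t⁻¹ ^ (d + 1) := by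
          rw [pow_succ, mul_assoc, hCt, mul_one]
        have e'' : (C t⁻¹ ^ (d + 2) * C t ^ (d + 3)  : MvPolynomial (Fin 2) ℂ) = C t := by
          rw [pow_succ _ (d + 2), ← mul_assoc, e, one_mul]
        generalize specialize t V = Vt at *
        generalize specialize t U = Ut at *
        linear_combination (-C t⁻¹ ^ (d + 2)) * hVt + (Vt + Polynomial.aeval Ut L) * e (d + 2)
          - X 1 * e' + Ut ^ d * e''
      · change _ = specialize t U
        simp [h1]

end PlaneAut

/-! ### Reduction of a general automorphism to the degeneration -/

/-- Over `ℂ` a translation removes the subleading term of a polynomial. -/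
theorem Polynomial.exists_shifted_monomial {n : ℕ} {P : Polynomial ℂ}
    (hP : P.natDegree = n + 2) :
    ∃ (l s : ℂ) (Q : Polynomial ℂ), l ≠ 0 ∧ Q.natDegree ≤ n ∧
      P = Polynomial.C l * (Polynomial.X + Polynomial.C s) ^ (n + 2) + Q := by
  have hl : P.coeff (n + 2) ≠ 0 := by
    rw [← hP]
    refine Polynomial.leadingCoeff_ne_zero.2 ?_
    rintro rfl
    simp at hP
  have hn : (n + 2 : ℂ) ≠ 0 := by exact_mod_cast Nat.succ_ne_zero (n + 1)
  -- The shift s is the solution of (n + 2) l s = `P.coeff (n + 1)`.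
  refine ⟨P.coeff (n + 2), P.coeff (n + 1) / ((n + 2) * P.coeff (n + 2)), _, hl, ?_,
    (add_sub_cancel _ _).symm⟩
  rw [Polynomial.natDegree_le_iff_coeff_eq_zero]
  intro N hN
  rw [Polynomial.coeff_sub, Polynomial.coeff_C_mul, Polynomial.coeff_X_add_C_pow]
  rcases Nat.lt_or_ge (n + 2) N with h | h
  · rw [Polynomial.coeff_eq_zero_of_natDegree_lt (hP ▸ h), Nat.choose_eq_zero_of_lt h]
    simp
  · obtain rfl | rfl : N = n + 1 ∨ N = n + 2 := by omega
    · rw [show n + 2 - (n + 1) = 1 by omega, pow_one, Nat.choose_succ_self_right]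
      push_cast
      field_simp
      ring
    · simp

open MvPolynomial in
/-- `𝒢_{(d+2)}` is contained in the Zariski closure of `𝒢_{(d,3)}` in `𝒢`, for every `d ≥ 2`. -/
theorem mainTheorem5 (d : ℕ) (hd : 2 ≤ d) :
    PlaneAut.polydegreeSet ℂ [d + 2] ⊆ closure (PlaneAut.polydegreeSet ℂ [d, 3]) := by
  intro θ hθ
  obtain ⟨α, τ, β, hα, hβ, ⟨a, b, c, P, ha, hb, h0, h1⟩, hdeg, rfl⟩ :=
    PlaneAut.HasPolydegree.exists_singleton hθ
  have hP : P.natDegree = d + 2 := by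
    have := PlaneAut.natDegree_le_degree h0
    have := PlaneAut.degree_le_of_component_eq h0 h1
    omega
  obtain ⟨l, s, Q, hl, hQ, hPQ⟩ := Polynomial.exists_shifted_monomial hP
  obtain ⟨p, q, S, r, hr, hq, hq0, hp, hpq⟩ :=
    Polynomial.exists_comp_cubic_eq (d := d) (by omega)
  -- Comparison of the linear terms in `hpq`.
  have hp0 : p.derivative.eval 0 * q.eval 0 = 1 := by
    have := congrArg (Polynomial.eval 0) (congrArg Polynomial.derivative hpq)
    rw [mul_comm]
    simpa [Polynomial.derivative_comp] using this
  have hp0' : -p.derivative.eval 0 ≠ 0 := neg_ne_zero.2 (left_ne_zero_of_mul_eq_one hp0)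
  -- Chosen so that (l/r) L(q(0)(Y + s)) = Q(Y), where Y + s is the translation made by `β₂`.
  set L : Polynomial ℂ := Polynomial.C (r / l)
    * Q.comp (Polynomial.C (q.eval 0)⁻¹ * Polynomial.X - Polynomial.C s) with hL
  have hLdeg : L.natDegree ≤ d := by
    refine (Polynomial.natDegree_C_mul_le _ _).trans ?_
    rw [Polynomial.natDegree_comp, Polynomial.natDegree_sub_C,
      Polynomial.natDegree_C_mul_X _ (inv_ne_zero hq0), mul_one]
    exact hQ
  have hlim := PlaneAut.isPolynomialLimit_triangular hd hq hq0 hp hLdeg hpq hp0'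
  set τ₀ := PlaneAut.triangular (-p.derivative.eval 0) (q.eval 0) 0 _ hp0' hq0 with hτ₀
  have hlam : -(l / r) ≠ 0 := neg_ne_zero.2 (div_ne_zero hl hr)
  -- The factor -(l/r) turns -r Y^(d+2) into l Y^(d+2); the other constants of `β₁` and `β₂` restore
  -- a, b and c.
  set β₁ := PlaneAut.triangular (-(l / r)) (b / q.eval 0) (c - b * s) 0 hlam (div_ne_zero hb hq0)
    with hβ₁
  set β₂ := PlaneAut.triangular (a / (-(l / r) * -p.derivative.eval 0)) 1 s 0
    (div_ne_zero ha (mul_ne_zero hlam hp0')) one_ne_zero with hβ₂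
  have hβ₁' : β₁.IsAffine := PlaneAut.isAffine_triangular _ _ (by simp)
  have hβ₂' : β₂.IsAffine := PlaneAut.isAffine_triangular _ _ (by simp)
  have hτ : τ = β₁ * τ₀ * β₂ := by
    ext1 i
    rw [PlaneAut.component_mul, PlaneAut.component_mul]
    fin_cases i
    · simp [h0, hτ₀, hβ₁, hβ₂, algHom_C, algebraMap_eq, ← Polynomial.aeval_algHom_apply, hPQ,
        Polynomial.aeval_comp, hL]
      rw [← mul_assoc (C (Polynomial.eval 0 q)⁻¹), ← map_mul C, inv_mul_cancel₀ hq0, map_one,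
        one_mul, add_sub_cancel_right]
      have e1 : (C (l / r) * C r : MvPolynomial (Fin 2) ℂ) = C l := by
        rw [← map_mul, div_mul_cancel₀ _ hr]
      have e2 : (C (l / r) * C (r / l) : MvPolynomial (Fin 2) ℂ) = 1 := by
        rw [← map_mul, div_mul_div_cancel₀ hr, div_self hl, map_one]
      have e3 : (C (l / r) * C (p.derivative.eval 0) * C (a / (l / r * p.derivative.eval 0)) :
          MvPolynomial (Fin 2) ℂ) = C a := by
        rw [← map_mul, ← map_mul, mul_div_cancel₀ _ (mul_ne_zero (neg_ne_zero.1 hlam)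
          (neg_ne_zero.1 hp0'))]
      linear_combination -(X 1 + C s) ^ (d + 2) * e1 - Polynomial.aeval (X 1) Q * e2 - X 0 * e3
    · simp [h1, hτ₀, hβ₁, hβ₂, algHom_C, algebraMap_eq]
      have e : (C (b / q.eval 0) * C (q.eval 0) : MvPolynomial (Fin 2) ℂ) = C b := by
        rw [← map_mul, div_mul_cancel₀ _ hq0]
      linear_combination -(X 1 + C s) * e
  rw [hτ, show α * (β₁ * τ₀ * β₂) * β = (α * β₁) * τ₀ * (β₂ * β) by simp only [mul_assoc]]
  refine (hlim.mul_mul ?_).mem_closure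
  rintro _ ⟨τ₁, τ₂, ht₁, ht₂, hd₁, hd₂, rfl⟩
  exact PlaneAut.hasPolydegree_pair hd (by norm_num) (hα.mul hβ₁') (PlaneAut.isAffine_swap ℂ)
    (hβ₂'.mul hβ) (PlaneAut.not_isTriangular_swap ℂ) ht₁ ht₂ hd₁ hd₂
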